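/- Let $\log$ be the logarithm to an arbitrary fixed base $b>1$. Let $\mathcal X$ be a finite alphabet, $E$ a finite-dimensional quantum system, and let $\rho_{XE}=\sum_{x} p_X(x)\,|x\rangle\langle x|\otimes\rho_{E,x}$ be a classical--quantum state, where $p_X$ is a probability distribution on $\mathcal X$ and each $\rho_{E,x}$ is a state (a positive semidefinite operator of trace one); put $\rho_E=\sum_x p_X(x)\rho_{E,x}$. *Extractable randomness.* For Hermitian $A$ let $\|A\|_+=\max_{0\le M\le 1}|\operatorname{Tr} MA|$. For a finite nonempty set $\mathcal Z$ and $f:\mathcal X\to\mathcal Z$ let $\rho^f_{ZE}=\sum_z |z\rangle\langle z|\otimes\sum_{x:f(x)=z}p_X(x)\rho_{E,x}$. A randomness extraction protocol with output alphabet $\mathcal Z$ is a random function $f:\mathcal X\to\mathcal Z$ (a probability distribution over hash functions), and its error is $\mathbb E_f\big\|\rho^f_{ZE}-\tfrac{1_Z}{|\mathcal Z|}\otimes\rho_E\big\|_+$. Let $\ell_\varepsilon(\rho_{XE})$ be the maximum of $\log|\mathcal Z|$ over all output alphabets and all protocols with error at most $\varepsilon$. *Smooth min-entropy.* For positive semidefinite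 $\rho'$ on $XE$ with $\operatorname{Tr}\rho'\le1$ let $P(\rho,\rho')=\sqrt{1-\|\sqrt{\rho}\sqrt{\rho'}\|_1^2}$ be the purified distance, and let $D_{\max}(\rho'\|\sigma)=\log\inf\{\lambda\ge0:\rho'\le\lambda\sigma\}$ (with value $+\infty$ if no such $\lambda$ exists). For $\delta\in(0,1)$ let $$H_{\min}^{\delta,P}(X|E)_\rho=-\inf_{\sigma_E}\ \inf_{\rho'}\ D_{\max}(\rho'\,\|\,1_X\otimes\sigma_E),$$ where $\sigma_E$ ranges over the states on $E$ and $\rho'$ over the operators on $XE$ with $\rho'\ge0$, $\operatorname{Tr}\rho'\le1$ and $P(\rho_{XE},\rho')\le\delta$. **Statement.** For all $\varepsilon\in(0,1)$ and all $\mu\in(0,\varepsilon)$, the maximum defining $\ell_\varepsilon(\rho_{XE})$ exists, and there is a randomness extraction protocol with error at most $\varepsilon$ whose output alphabet satisfies $$\log|\mathcal Z|\ \ge\ H_{\min}^{\sqrt{\varepsilon-\mu},\,P}(X|E)_\rho-\log\frac{1}{4\mu^3}.$$ In particular, $$\ell_\varepsilon(\rho_{XE})\ \ge\ H_{\min}^{\sqrt{\varepsilon-\mu},\,P}(X|E)_\rho-\log\frac{1}{4\mu^3}.$$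 -/

import Mathlib

open scoped MatrixOrder ComplexOrder Kronecker NNReal ENNReal

namespace PrivacyAmp

/-- A density operator on the Hilbert space `ℂ^n`. -/
def IsState {n : Type*} [Fintype n] (ρ : Matrix n n ℂ) : Prop :=
  0 ≤ ρ ∧ ρ.trace = 1

/-- A sub-normalised state on `ℂ^n`. -/
def IsSubState {n : Type*} [Fintype n] (ρ : Matrix n n ℂ) : Prop :=
  0 ≤ ρ ∧ ρ.trace ≤ 1

/-- The Schatten 1-norm `Tr √(A† A)`. -/
noncomputable def traceNorm {n : Type*} [Fintype n] [DecidableEq n] (A : Matrix n n ℂ) : ℝ :=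
  (CFC.sqrt (A.conjTranspose * A)).trace.re

/-- The norm `‖A‖₊ = max { |Tr (M A)| : 0 ≤ M ≤ 1 }` of the generalised trace distance. -/
noncomputable def normPlus {n : Type*} [Fintype n] [DecidableEq n] (A : Matrix n n ℂ) : ℝ :=
  sSup {r : ℝ | ∃ M : Matrix n n ℂ, 0 ≤ M ∧ M ≤ 1 ∧ r = ‖(M * A).trace‖}

/-- The (squared) fidelity `‖√ρ √ρ'‖₁²`. -/
noncomputable def fidelity {n : Type*} [Fintype n] [DecidableEq n] (ρ ρ' : Matrix n n ℂ) : ℝ :=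
  traceNorm (CFC.sqrt ρ * CFC.sqrt ρ') ^ 2

/-- The purified distance between a state `ρ` and a sub-normalised state `ρ'`. -/
noncomputable def purifiedDist {n : Type*} [Fintype n] [DecidableEq n]
    (ρ ρ' : Matrix n n ℂ) : ℝ :=
  Real.sqrt (1 - fidelity ρ ρ')

/-- The base-`b` logarithm on `[0, ∞]`, with `log 0 = -∞` and `log ∞ = ∞` (for `1 < b`). -/
noncomputable def elogb (b : ℝ) (x : ℝ≥0∞) : EReal :=
  ENNReal.log x / ((Real.log b : ℝ) : EReal)

/-- The max-relative entropy `log inf { λ ≥ 0 : A ≤ λ B }`. -/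
noncomputable def Dmax (b : ℝ) {n : Type*} [Fintype n] (A B : Matrix n n ℂ) : EReal :=
  elogb b (⨅ (t : ℝ≥0) (_ : A ≤ ((t : ℝ) : ℂ) • B), (t : ℝ≥0∞))

/-- The max-relative entropy smoothed in purified distance over sub-normalised states. -/
noncomputable def DmaxP (b δ : ℝ) {n : Type*} [Fintype n] [DecidableEq n]
    (ρ σ : Matrix n n ℂ) : EReal :=
  ⨅ (ρ' : Matrix n n ℂ) (_ : IsSubState ρ' ∧ purifiedDist ρ ρ' ≤ δ), Dmax b ρ' σ

/-- The smooth conditional min-entropy `H_min^{δ,P}(X|E)_ρ`, optimised over states `σ` of `E`. -/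
noncomputable def HminP (b δ : ℝ) {X E : Type*} [Fintype X] [DecidableEq X] [Fintype E]
    [DecidableEq E] (ρ : Matrix (X × E) (X × E) ℂ) : EReal :=
  -⨅ (σ : Matrix E E ℂ) (_ : IsState σ), DmaxP b δ ρ ((1 : Matrix X X ℂ) ⊗ₖ σ)

/-- The data of a classical–quantum state `∑ₓ p(x) |x⟩⟨x| ⊗ ρₓ`. -/
structure CQState (X E : Type*) [Fintype X] [Fintype E] where
  p : X → ℝ
  p_nonneg : ∀ x, 0 ≤ p x
  p_sum : ∑ x, p x = 1
  st : X → Matrix E E ℂ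
  st_isState : ∀ x, IsState (st x)

/-- The operator `ρ_{XE} = ∑ₓ p(x) |x⟩⟨x| ⊗ ρₓ`. -/
noncomputable def CQState.op {X E : Type*} [Fintype X] [DecidableEq X] [Fintype E]
    (ρ : CQState X E) : Matrix (X × E) (X × E) ℂ :=
  ∑ x, (ρ.p x : ℂ) • (Matrix.single x x (1 : ℂ) ⊗ₖ ρ.st x)

/-- The marginal `ρ_E`. -/
noncomputable def CQState.marginal {X E : Type*} [Fintype X] [Fintype E]
    (ρ : CQState X E) : Matrix E E ℂ :=
  ∑ x, (ρ.p x : ℂ) • ρ.st x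

/-- The hashed operator `ρ^f_{ZE} = ∑_z |z⟩⟨z| ⊗ ∑_{x : f x = z} p(x) ρₓ`. -/
noncomputable def CQState.hashed {X E Z : Type*} [Fintype X] [Fintype E] [Fintype Z]
    [DecidableEq Z] (ρ : CQState X E) (f : X → Z) : Matrix (Z × E) (Z × E) ℂ :=
  ∑ z, Matrix.single z z (1 : ℂ) ⊗ₖ
    (∑ x ∈ Finset.univ.filter (fun x => f x = z), (ρ.p x : ℂ) • ρ.st x)

/-- The distance `‖ρ^f_{ZE} - (1/|Z|) ⊗ ρ_E‖₊` of the hashed state from the ideal one. -/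
noncomputable def CQState.hashError {X E Z : Type*} [Fintype X] [Fintype E] [DecidableEq E]
    [Fintype Z] [DecidableEq Z] (ρ : CQState X E) (f : X → Z) : ℝ :=
  normPlus (ρ.hashed f -
    ((Fintype.card Z : ℂ)⁻¹ • (1 : Matrix Z Z ℂ)) ⊗ₖ ρ.marginal)

/-- A randomness extraction protocol: a probability distribution over hash functions `X → Z`.
(A family of hash functions is recovered as the support of the distribution.) -/
structure Protocol (X Z : Type*) [Fintype X] [DecidableEq X] [Fintype Z] where
  prob : (X → Z) → ℝ
  prob_nonneg : ∀ f, 0 ≤ prob f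
  prob_sum : ∑ f, prob f = 1

/-- The expected error `𝔼_f ‖ρ^f_{ZE} - (1/|Z|) ⊗ ρ_E‖₊` of a protocol. -/
noncomputable def Protocol.error {X Z E : Type*} [Fintype X] [DecidableEq X] [Fintype Z]
    [DecidableEq Z] [Fintype E] [DecidableEq E] (F : Protocol X Z) (ρ : CQState X E) : ℝ :=
  ∑ f, F.prob f * ρ.hashError f

/-- The set of all values `log |Z|` that are achievable with error at most `ε`. -/
def achievableLengths (b ε : ℝ) {X E : Type*} [Fintype X] [DecidableEq X] [Fintype E]
    [DecidableEq E] (ρ : CQState X E) : Set ℝ :=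
  {r : ℝ | ∃ m : ℕ, 1 ≤ m ∧ ∃ F : Protocol X (Fin m), F.error ρ ≤ ε ∧ r = Real.logb b m}

/-- The extractable randomness `ℓ_ε(ρ_{XE})` with trace distance error `ε`. -/
noncomputable def extractable (b ε : ℝ) {X E : Type*} [Fintype X] [DecidableEq X] [Fintype E]
    [DecidableEq E] (ρ : CQState X E) : ℝ :=
  sSup (achievableLengths b ε ρ)

end PrivacyAmp

set_option linter.unusedSectionVars false

/-! Hash with a uniformly random function. Let R = √ρ_XE. For a smoothing candidate ρ' take a
contraction U with Re Tr(R √ρ' U) = ‖R √ρ'‖₁ ≥ φ := √(1-ε+μ), and put K = c √ρ' U with c ≥ 0 free.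
For the block rows, p(x) ρ_x = R_x R_x† = T_x T_x† + (S_x K_x† + h.c.), where T = R - K and S = R -
K/2.

The T-part costs at most ‖T‖² ≤ 1 - 2cφ + c² (Frobenius norm). If the diagonal blocks of ρ' are
below G, then K_x = √G C_x with C_x† C_x ≤ c², and the cross term is handled by Young's inequality
and a second-moment computation in which distinct x, y decouple. It costs at most any B > 0 with B²
≥ (|Z|-1) Tr G · c²(1 - cφ + c²/4). A suitable c makes the total at most ε whenever (|Z|-1) Tr G ≤
4μ³ (`CQState.error_uniform_le_of_purifiedDist`).

The factor |Z|-1 removes any rounding loss. A largest achievable m exists because small error forces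
|Z| ≤ |X|/(1-ε). A feasible λ with mλ < 4μ³ would make m+1 achievable
(`CQState.error_uniform_succ_le`), so every feasible λ is at least 4μ³/m, which is the claim. -/

namespace PrivacyAmp

open Matrix

/-! ### Frobenius norm and operator inequalities -/

section Frobenius

variable {k l n : Type*} [Fintype k] [Fintype l] [Fintype n]

/-- The squared Frobenius norm `Tr (A A†)`. -/
noncomputable def frobSq (A : Matrix k l ℂ) : ℝ := (A * Aᴴ).trace.re

theorem re_trace_nonneg {A : Matrix n n ℂ} (hA : 0 ≤ A) : 0 ≤ A.trace.re :=
  (Complex.le_def.1 (nonneg_iff_posSemidef.1 hA).trace_nonneg).1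

theorem re_trace_mono {A B : Matrix n n ℂ} (h : A ≤ B) : A.trace.re ≤ B.trace.re := by
  have := re_trace_nonneg (sub_nonneg.2 h)
  rw [trace_sub, Complex.sub_re] at this
  linarith

theorem frobSq_nonneg (A : Matrix k l ℂ) : 0 ≤ frobSq A :=
  re_trace_nonneg (nonneg_iff_posSemidef.2 (posSemidef_self_mul_conjTranspose A))

theorem re_trace_conjTranspose (A : Matrix n n ℂ) : Aᴴ.trace.re = A.trace.re := by
  rw [trace_conjTranspose]; simp

theorem conjTranspose_mul_mul_mono {A B : Matrix n n ℂ} (h : A ≤ B) (C : Matrix n k ℂ) :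
    Cᴴ * A * C ≤ Cᴴ * B * C := by
  rw [le_iff] at h ⊢
  have := h.conjTranspose_mul_mul_same C
  rwa [Matrix.mul_sub, Matrix.sub_mul] at this

theorem mul_mul_conjTranspose_mono {A B : Matrix n n ℂ} (h : A ≤ B) (C : Matrix k n ℂ) :
    C * A * Cᴴ ≤ C * B * Cᴴ := by
  simpa using conjTranspose_mul_mul_mono h Cᴴ

/-- Young's inequality for the Hilbert–Schmidt pairing. -/
theorem two_re_trace_mul_le (P : Matrix k l ℂ) (Q : Matrix l k ℂ) {t : ℝ} (ht : 0 < t) :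
    2 * (P * Q).trace.re ≤ t * frobSq P + t⁻¹ * frobSq Q := by
  have h := frobSq_nonneg ((t : ℂ) • Pᴴ - Q)
  have e : frobSq ((t : ℂ) • Pᴴ - Q) =
      t ^ 2 * frobSq P - 2 * t * (P * Q).trace.re + frobSq Q := by
    have h1 : (Pᴴ * P).trace = (P * Pᴴ).trace := trace_mul_comm _ _
    have h2 : (Pᴴ * Qᴴ).trace.re = (P * Q).trace.re := by
      rw [← conjTranspose_mul, re_trace_conjTranspose, trace_mul_comm]
    have h3 : (Q * P).trace = (P * Q).trace := trace_mul_comm _ _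
    simp only [frobSq, conjTranspose_sub, conjTranspose_smul, conjTranspose_conjTranspose,
      Matrix.sub_mul, Matrix.mul_sub, Matrix.smul_mul, Matrix.mul_smul, trace_sub, trace_smul,
      Complex.sub_re, smul_eq_mul, h1, h3, RCLike.star_def, Complex.conj_ofReal,
      Complex.re_ofReal_mul, h2]
    ring
  rw [e] at h
  have : t * (2 * (P * Q).trace.re) ≤ t * (t * frobSq P + t⁻¹ * frobSq Q) := by
    have : t * (t * frobSq P + t⁻¹ * frobSq Q) = t ^ 2 * frobSq P + frobSq Q := by
      field_simp
    rw [this]; linarith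
  exact le_of_mul_le_mul_left this ht

theorem re_trace_mul_self_conjTranspose (M : Matrix k k ℂ) (T : Matrix k l ℂ) :
    (M * (T * Tᴴ)).trace = (Tᴴ * M * T).trace := by
  rw [← Matrix.mul_assoc, trace_mul_comm, Matrix.mul_assoc]

theorem re_trace_mul_self_conjTranspose_nonneg {M : Matrix k k ℂ} (hM : 0 ≤ M)
    (T : Matrix k l ℂ) : 0 ≤ (M * (T * Tᴴ)).trace.re := by
  rw [re_trace_mul_self_conjTranspose]
  refine re_trace_nonneg ?_
  simpa using conjTranspose_mul_mul_mono hM T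

theorem re_trace_mul_self_conjTranspose_le [DecidableEq k] {M : Matrix k k ℂ} (hM : M ≤ 1)
    (T : Matrix k l ℂ) : (M * (T * Tᴴ)).trace.re ≤ frobSq T := by
  rw [re_trace_mul_self_conjTranspose, frobSq, trace_mul_comm T]
  simpa using re_trace_mono (conjTranspose_mul_mul_mono hM T)

/-- Follows from the identity 1 - C†C = (1 - C†C)² + C†(1 - CC†)C, without spectral theory. -/
theorem conjTranspose_mul_self_le_one [DecidableEq k] [DecidableEq l] {C : Matrix k l ℂ}
    (h : C * Cᴴ ≤ 1) : Cᴴ * C ≤ 1 := by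
  have h1 : 0 ≤ Cᴴ * (1 - C * Cᴴ) * C := by
    simpa using conjTranspose_mul_mul_mono (sub_nonneg.2 h) C
  have h2 : 0 ≤ (1 - Cᴴ * C)ᴴ * (1 - Cᴴ * C) :=
    nonneg_iff_posSemidef.2 (posSemidef_conjTranspose_mul_self _)
  rw [← sub_nonneg]
  convert add_nonneg h2 h1 using 1
  simp only [conjTranspose_sub, conjTranspose_one, conjTranspose_mul, conjTranspose_conjTranspose]
  simp only [Matrix.mul_sub, Matrix.sub_mul, Matrix.mul_one, Matrix.one_mul, Matrix.mul_assoc]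
  abel

theorem frobSq_mul_conjTranspose_le [DecidableEq n] {C : Matrix k n ℂ} (h : Cᴴ * C ≤ 1)
    (S : Matrix l n ℂ) : frobSq (S * Cᴴ) ≤ frobSq S := by
  have := re_trace_mono (mul_mul_conjTranspose_mono h S)
  simpa [frobSq, Matrix.mul_assoc] using this

/-- The difference of the two sides is M - M² = M(1-M)M + (1-M)M(1-M). Centring a test operator at
1/2 thus gains a factor 4 over the bound M² ≤ 1. -/
theorem sub_half_mul_self_le [DecidableEq n] {M : Matrix n n ℂ} (h0 : 0 ≤ M) (h1 : M ≤ 1) :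
    (M - (1 / 2 : ℂ) • 1) * (M - (1 / 2 : ℂ) • 1)ᴴ ≤ (1 / 4 : ℂ) • 1 := by
  have hM : Mᴴ = M := (nonneg_iff_posSemidef.1 h0).isHermitian
  have e1 : 0 ≤ Mᴴ * (1 - M) * M := by
    have := conjTranspose_mul_mul_mono (sub_nonneg.2 h1) M
    rwa [Matrix.mul_zero, Matrix.zero_mul] at this
  have e2 : 0 ≤ (1 - M)ᴴ * M * (1 - M) := by
    have := conjTranspose_mul_mul_mono h0 (1 - M)
    rwa [Matrix.mul_zero, Matrix.zero_mul] at this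
  have e3 : (1 / 4 : ℂ) • 1 - (M - (1 / 2 : ℂ) • 1) * (M - (1 / 2 : ℂ) • 1)ᴴ =
      Mᴴ * (1 - M) * M + (1 - M)ᴴ * M * (1 - M) := by
    rw [conjTranspose_sub, conjTranspose_sub, conjTranspose_smul, conjTranspose_one, hM,
      show star (1 / 2 : ℂ) = 1 / 2 by simp]
    simp only [Matrix.mul_sub, Matrix.sub_mul, Matrix.mul_one, Matrix.one_mul, Matrix.mul_assoc,
      Matrix.smul_mul, Matrix.mul_smul]
    module
  rw [← sub_nonneg, e3]
  exact add_nonneg e1 e2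

theorem frobSq_mul_sub_half_le [DecidableEq n] {M : Matrix n n ℂ} (h0 : 0 ≤ M) (h1 : M ≤ 1)
    (A : Matrix k n ℂ) : frobSq (A * (M - (1 / 2 : ℂ) • 1)) ≤ frobSq A / 4 := by
  have := re_trace_mono (mul_mul_conjTranspose_mono (sub_half_mul_self_le h0 h1) A)
  rw [frobSq, conjTranspose_mul]
  simp only [Matrix.mul_assoc, Matrix.mul_smul, Matrix.smul_mul, trace_smul, Matrix.one_mul]
    at this ⊢
  refine this.trans (le_of_eq ?_)
  rw [frobSq, smul_eq_mul, show (1 / 4 : ℂ) = ((1 / 4 : ℝ) : ℂ) by push_cast; rfl,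
    Complex.re_ofReal_mul]
  ring

/-- The squared Frobenius norm is the sum over the rows of a block decomposition. -/
theorem sum_frobSq_rows (A : Matrix (k × l) n ℂ) :
    ∑ x, frobSq (A.submatrix (fun e => (x, e)) id) = frobSq A := by
  simp [frobSq, trace, Matrix.mul_apply, Fintype.sum_prod_type]

end Frobenius

/-! ### Polar decomposition and the norm `normPlus` -/

section SquareMatrix

variable {n : Type*} [Fintype n] [DecidableEq n]

/-- A contraction that plays the role of the unitary in the polar decomposition. -/
theorem exists_contraction_trace_eq_traceNorm (A : Matrix n n ℂ) :
    ∃ U : Matrix n n ℂ, U * Uᴴ ≤ 1 ∧ (A * U).trace.re = traceNorm A := by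
  have hAA : 0 ≤ Aᴴ * A := nonneg_iff_posSemidef.2 (posSemidef_conjTranspose_mul_self A)
  set H := CFC.sqrt (Aᴴ * A) with hH
  have hH0 : 0 ≤ H := CFC.sqrt_nonneg _
  have hHH : H * H = Aᴴ * A := CFC.sqrt_mul_sqrt_self _ hAA
  have hsa : IsSelfAdjoint H := IsSelfAdjoint.of_nonneg hH0
  have hc : ∀ f : ℝ → ℝ, ContinuousOn f (spectrum ℝ H) := fun f =>
    Matrix.finite_real_spectrum.continuousOn f
  -- Since 0⁻¹ = 0, J is the pseudo-inverse of H = |A|. With U = J A†, the product U U† = H J is the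
  -- support projection of H, and Tr(AU) = Tr(J H²) = Tr H.
  set J := cfc (fun x : ℝ => x⁻¹) H with hJ
  have hJsa : Jᴴ = J := (cfc_predicate (fun x : ℝ => x⁻¹) H : IsSelfAdjoint J)
  have e1 : J * (H * H) = H := by
    have h1 : H * H = cfc (fun x : ℝ => x * x) H := by
      rw [cfc_mul (fun x : ℝ => x) (fun x => x) H (hc _) (hc _), cfc_id' ℝ H]
    rw [h1, hJ, ← cfc_mul _ _ H (hc _) (hc _)]
    conv_rhs => rw [← cfc_id' ℝ H]
    congr 1
    ext x
    by_cases hx : x = 0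
    · simp [hx]
    · field_simp
  have e2 : J * H ≤ 1 := by
    have : J * H = cfc (fun x : ℝ => x⁻¹ * x) H := by
      rw [cfc_mul (fun x : ℝ => x⁻¹) (fun x => x) H (hc _) (hc _), cfc_id' ℝ H]
    rw [this]
    refine cfc_le_one _ _ fun x _ => ?_
    by_cases hx : x = 0
    · simp [hx]
    · simp [hx]
  have e3 : H * J = J * H := by
    have : (J * H)ᴴ = J * H := by
      have : J * H = cfc (fun x : ℝ => x⁻¹ * x) H := by
        rw [cfc_mul (fun x : ℝ => x⁻¹) (fun x => x) H (hc _) (hc _), cfc_id' ℝ H]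
      rw [this]
      exact (cfc_predicate (fun x : ℝ => x⁻¹ * x) H : IsSelfAdjoint _)
    rw [conjTranspose_mul, hJsa] at this
    rwa [show Hᴴ = H from hsa] at this
  refine ⟨J * Aᴴ, ?_, ?_⟩
  · rw [conjTranspose_mul, conjTranspose_conjTranspose, hJsa, Matrix.mul_assoc,
      ← Matrix.mul_assoc Aᴴ, ← hHH, ← Matrix.mul_assoc, e1, e3]
    exact e2
  · rw [← Matrix.mul_assoc, trace_mul_comm, ← Matrix.mul_assoc, ← hHH, trace_mul_comm, e1]
    rfl

theorem traceNorm_nonneg (A : Matrix n n ℂ) : 0 ≤ traceNorm A :=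
  re_trace_nonneg (CFC.sqrt_nonneg _)

theorem norm_trace_mul_eq_of_isHermitian {n : Type*} [Fintype n] {M A : Matrix n n ℂ} (hM : M.IsHermitian)
    (hA : A.IsHermitian) : ‖(M * A).trace‖ = |(M * A).trace.re| := by
  have h : star (M * A).trace = (M * A).trace := by
    rw [← trace_conjTranspose, conjTranspose_mul, hM.eq, hA.eq, trace_mul_comm]
  have h' : (M * A).trace = (((M * A).trace.re : ℝ) : ℂ) :=
    (Complex.conj_eq_iff_re.1 h).symm
  rw [h', Complex.norm_real, Complex.ofReal_re, Real.norm_eq_abs]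

/-- As A is traceless, replacing M by 1 - M flips the sign of Tr(MA), so a one-sided bound is
two-sided. -/
theorem norm_trace_mul_le {A : Matrix n n ℂ} (hA : A.IsHermitian) (htr : A.trace = 0) {c : ℝ}
    (h : ∀ M : Matrix n n ℂ, 0 ≤ M → M ≤ 1 → (M * A).trace.re ≤ c) {M : Matrix n n ℂ}
    (h0 : 0 ≤ M) (h1 : M ≤ 1) : ‖(M * A).trace‖ ≤ c := by
  rw [norm_trace_mul_eq_of_isHermitian (nonneg_iff_posSemidef.1 h0).isHermitian hA]
  refine abs_le'.2 ⟨h M h0 h1, ?_⟩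
  have := h (1 - M) (sub_nonneg.2 h1) (sub_le_self _ h0)
  rwa [Matrix.sub_mul, Matrix.one_mul, trace_sub, htr, zero_sub, Complex.neg_re] at this

/-- For a traceless Hermitian operator, `‖A‖₊` is bounded by the one-sided supremum. -/
theorem normPlus_le {A : Matrix n n ℂ} (hA : A.IsHermitian) (htr : A.trace = 0) {c : ℝ}
    (h : ∀ M : Matrix n n ℂ, 0 ≤ M → M ≤ 1 → (M * A).trace.re ≤ c) : normPlus A ≤ c := by
  refine csSup_le ⟨_, 0, le_rfl, zero_le_one, rfl⟩ ?_
  rintro r ⟨M, h0, h1, rfl⟩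
  exact norm_trace_mul_le hA htr h h0 h1

theorem re_trace_mul_le_normPlus {A : Matrix n n ℂ} (hA : A.IsHermitian) (htr : A.trace = 0)
    {M : Matrix n n ℂ} (h0 : 0 ≤ M) (h1 : M ≤ 1) : (M * A).trace.re ≤ normPlus A := by
  refine (Complex.re_le_norm _).trans (le_csSup ⟨?_, ?_⟩ ⟨M, h0, h1, rfl⟩)
  -- A crude bound, needed only so that the supremum in `normPlus` is over a bounded set.
  · exact frobSq (1 : Matrix n n ℂ) / 4 + frobSq A
  rintro r ⟨M, h0, h1, rfl⟩
  refine norm_trace_mul_le hA htr (fun M h0 h1 => ?_) h0 h1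
  have e1 := two_re_trace_mul_le (M - (1 / 2 : ℂ) • 1) A one_pos
  have e2 := frobSq_mul_sub_half_le h0 h1 (1 : Matrix n n ℂ)
  have e4 := frobSq_nonneg (1 : Matrix n n ℂ)
  have e5 := frobSq_nonneg A
  rw [Matrix.one_mul] at e2
  have e6 : (M - (1 / 2 : ℂ) • 1) * A = M * A - (1 / 2 : ℂ) • A := by
    rw [Matrix.sub_mul, Matrix.smul_mul, Matrix.one_mul]
  rw [e6, trace_sub, trace_smul, htr, smul_zero, sub_zero] at e1
  linarith

end SquareMatrix

/-! ### Second-moment analysis of random hashing -/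

section Hashing

variable {X E Z N : Type*} [Fintype X] [DecidableEq X] [Fintype E] [DecidableEq E] [Fintype Z]
  [DecidableEq Z] [Fintype N]

/-- The matrix of the projection onto the orthogonal complement of the constant functions. -/
noncomputable def centred (y z : Z) : ℝ := (if y = z then 1 else 0) - (Fintype.card Z : ℝ)⁻¹

theorem sum_centred_right [Nonempty Z] (y : Z) : ∑ z, centred y z = 0 := by
  simp [centred]

theorem centred_comm (y z : Z) : centred y z = centred z y := by
  simp [centred, eq_comm]

theorem sum_centred_left [Nonempty Z] (z : Z) : ∑ y, centred y z = 0 := by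
  simp_rw [centred_comm _ z, sum_centred_right]

theorem sum_centred_mul (r : Z → ℝ) (y : Z) :
    ∑ z, centred y z * r z = r y - (Fintype.card Z : ℝ)⁻¹ * ∑ z, r z := by
  simp [centred, sub_mul, Finset.mul_sum]

theorem sum_centred_mul_centred [Nonempty Z] (x y : Z) :
    ∑ z, centred x z * centred y z = centred x y := by
  rw [sum_centred_mul, sum_centred_right, mul_zero, sub_zero, centred_comm]

/-- Decoupling of distinct inputs: with all other values of f fixed, f x still ranges over all of Z,
and `centred` sums to zero. -/
theorem sum_centred_apply_of_ne [Nonempty Z] {x y : X} (h : x ≠ y) :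
    ∑ f : X → Z, centred (f x) (f y) = 0 := by
  rw [← (Equiv.funSplitAt x Z).symm.sum_comp, Fintype.sum_prod_type_right]
  refine Finset.sum_eq_zero fun f _ => ?_
  simpa [Equiv.funSplitAt, Equiv.piSplitAt, h.symm] using sum_centred_left (f ⟨y, h.symm⟩)

theorem frobSq_sum_smul {X E N : Type*} [Fintype X] [Fintype E] [Fintype N] (a : X → ℝ) (V : X → Matrix E N ℂ) :
    frobSq (∑ x, (a x : ℂ) • V x) = ∑ x, ∑ y, a x * a y * (V x * (V y)ᴴ).trace.re := by
  simp only [frobSq, conjTranspose_sum, Matrix.sum_mul, Matrix.mul_sum, trace_sum, Complex.re_sum,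
    conjTranspose_smul, Matrix.smul_mul, Matrix.mul_smul, trace_smul, smul_eq_mul,
    RCLike.star_def, Complex.conj_ofReal, Complex.re_ofReal_mul, mul_assoc]
  rw [Finset.sum_comm]
  refine Finset.sum_congr rfl fun x _ => ?_
  rw [Finset.mul_sum]
  exact Finset.sum_congr rfl fun y _ => by ring

theorem sum_frobSq_centred [Nonempty Z] (f : X → Z) (V : X → Matrix E N ℂ) :
    ∑ z, frobSq (∑ x, (centred (f x) z : ℂ) • V x) =
      ∑ x, ∑ y, centred (f x) (f y) * (V x * (V y)ᴴ).trace.re := by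
  simp_rw [frobSq_sum_smul]
  rw [Finset.sum_comm]
  refine Finset.sum_congr rfl fun x _ => ?_
  rw [Finset.sum_comm]
  refine Finset.sum_congr rfl fun y _ => ?_
  rw [← Finset.sum_mul, sum_centred_mul_centred]

/-- The mean square deviation of a randomly hashed family from its average. -/
theorem sum_sum_frobSq_centred [Nonempty Z] (V : X → Matrix E N ℂ) :
    ∑ f : X → Z, ∑ z, frobSq (∑ x, (centred (f x) z : ℂ) • V x) =
      (Fintype.card Z : ℝ) ^ Fintype.card X *
        ((1 - (Fintype.card Z : ℝ)⁻¹) * ∑ x, frobSq (V x)) := by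
  simp_rw [sum_frobSq_centred]
  rw [Finset.sum_comm]
  simp_rw [Finset.mul_sum]
  refine Finset.sum_congr rfl fun x _ => ?_
  rw [Finset.sum_comm, Finset.sum_eq_single x]
  · simp [centred, frobSq]
  · intro y _ hy
    rw [← Finset.sum_mul, sum_centred_apply_of_ne hy.symm, zero_mul]
  · simp

theorem CQState.hashed_sub_ideal_apply (ρ : CQState X E) (f : X → Z) (z z' : Z) (e e' : E) :
    (ρ.hashed f - ((Fintype.card Z : ℂ)⁻¹ • (1 : Matrix Z Z ℂ)) ⊗ₖ ρ.marginal) (z, e) (z', e') =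
      if z = z' then (∑ x, (centred (f x) z : ℂ) • ((ρ.p x : ℂ) • ρ.st x)) e e' else 0 := by
  have h1 : ρ.hashed f (z, e) (z', e') =
      if z = z' then (∑ x, (if f x = z then 1 else 0 : ℂ) * (ρ.p x * ρ.st x e e')) else 0 := by
    simp only [CQState.hashed, Matrix.sum_apply, kroneckerMap_apply, Matrix.single_apply,
      Matrix.smul_apply, smul_eq_mul]
    rw [Finset.sum_eq_single z]
    · by_cases h : z = z' <;> simp [h, Finset.sum_filter]
    · intro y _ hy; simp [hy]
    · simp
  rw [Matrix.sub_apply, h1]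
  simp only [kroneckerMap_apply, CQState.marginal, Matrix.sum_apply, Matrix.smul_apply,
    smul_eq_mul, Matrix.one_apply]
  by_cases h : z = z'
  · simp only [h, centred, if_true, mul_one, sub_mul, Finset.sum_sub_distrib, Finset.mul_sum,
      Complex.ofReal_sub, Complex.ofReal_inv, Complex.ofReal_natCast]
    congr 1
    exact Finset.sum_congr rfl fun x _ => by split_ifs <;> simp
  · simp [h]

theorem CQState.trace_mul_hashed_sub_ideal (ρ : CQState X E) (f : X → Z)
    (M : Matrix (Z × E) (Z × E) ℂ) :
    (M * (ρ.hashed f - ((Fintype.card Z : ℂ)⁻¹ • (1 : Matrix Z Z ℂ)) ⊗ₖ ρ.marginal)).trace =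
      ∑ z, (M.submatrix (fun e => (z, e)) (fun e => (z, e)) *
        ∑ x, (centred (f x) z : ℂ) • ((ρ.p x : ℂ) • ρ.st x)).trace := by
  simp only [trace, diag_apply, Matrix.mul_apply, Fintype.sum_prod_type,
    CQState.hashed_sub_ideal_apply, submatrix_apply]
  refine Finset.sum_congr rfl fun z _ => Finset.sum_congr rfl fun e _ => ?_
  rw [Finset.sum_eq_single z]
  · simp
  · intro y _ hy; simp [hy]
  · simp

theorem CQState.trace_hashed_sub_ideal [Nonempty Z] (ρ : CQState X E) (f : X → Z) :
    (ρ.hashed f - ((Fintype.card Z : ℂ)⁻¹ • (1 : Matrix Z Z ℂ)) ⊗ₖ ρ.marginal).trace = 0 := by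
  have h := ρ.trace_mul_hashed_sub_ideal f 1
  have h1 : ∀ z : Z, (1 : Matrix (Z × E) (Z × E) ℂ).submatrix (fun e => (z, e))
      (fun e => (z, e)) = 1 := fun z => Matrix.submatrix_one _ (Prod.mk_right_injective z)
  simp only [h1, Matrix.one_mul] at h
  rw [h, ← trace_sum, Finset.sum_comm]
  simp_rw [← Finset.sum_smul, ← Complex.ofReal_sum, sum_centred_right]
  simp

theorem CQState.isHermitian_hashed_sub_ideal (ρ : CQState X E) (f : X → Z) :
    (ρ.hashed f - ((Fintype.card Z : ℂ)⁻¹ • (1 : Matrix Z Z ℂ)) ⊗ₖ ρ.marginal).IsHermitian := by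
  have h (z : Z) : (∑ x, (centred (f x) z : ℂ) • ((ρ.p x : ℂ) • ρ.st x)).IsHermitian := by
    simp only [IsHermitian, conjTranspose_sum, conjTranspose_smul, RCLike.star_def,
      Complex.conj_ofReal]
    exact Finset.sum_congr rfl fun x _ => by
      rw [(nonneg_iff_posSemidef.1 (ρ.st_isState x).1).isHermitian.eq]
  ext ⟨z, e⟩ ⟨z', e'⟩
  rw [conjTranspose_apply, ρ.hashed_sub_ideal_apply, ρ.hashed_sub_ideal_apply]
  by_cases hz : z = z'
  · subst hz
    simpa using (h z).apply e e'
  · simp [hz, Ne.symm hz]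

/-- The one-shot deviation estimate for a fixed hash function. -/
theorem CQState.hashError_le [Nonempty Z] (ρ : CQState X E) (f : X → Z)
    {R K C : X → Matrix E N ℂ} {A : Matrix E E ℂ} (hA : A.IsHermitian)
    (hR : ∀ x, R x * (R x)ᴴ = (ρ.p x : ℂ) • ρ.st x) (hK : ∀ x, K x = A * C x)
    {t : ℝ} (ht : 0 < t) :
    ρ.hashError f ≤ ∑ x, frobSq (R x - K x) + t * Fintype.card Z * frobSq A / 4 +
      t⁻¹ * ∑ z, frobSq (∑ x, (centred (f x) z : ℂ) •
        ((R x - (1 / 2 : ℂ) • K x) * (C x)ᴴ)) := by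
  set T : X → Matrix E N ℂ := fun x => R x - K x with hT
  set V : X → Matrix E E ℂ := fun x => (R x - (1 / 2 : ℂ) • K x) * (C x)ᴴ with hV
  set D : Z → Matrix E E ℂ := fun z => ∑ x, (centred (f x) z : ℂ) • V x with hD
  -- With T = R - K this is RR† = TT† + (R - K/2)K† + K(R - K/2)†. Splitting K symmetrically leaves
  -- no KK† remainder.
  have hdec (x : X) : (ρ.p x : ℂ) • ρ.st x = T x * (T x)ᴴ + (V x * A + (V x * A)ᴴ) := by
    have hVA : V x * A = (R x - (1 / 2 : ℂ) • K x) * (K x)ᴴ := by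
      rw [show (K x)ᴴ = (C x)ᴴ * A by rw [hK, conjTranspose_mul, hA.eq]]
      exact Matrix.mul_assoc _ _ _
    rw [hVA, ← hR x]
    simp only [hT, conjTranspose_mul, conjTranspose_sub, conjTranspose_smul,
      conjTranspose_conjTranspose, Matrix.mul_sub, Matrix.sub_mul, Matrix.smul_mul]
    rw [show star (1 / 2 : ℂ) = 1 / 2 by simp]
    module
  have hDA (z : Z) : ∑ x, (centred (f x) z : ℂ) • ((ρ.p x : ℂ) • ρ.st x) =
      ∑ x, (centred (f x) z : ℂ) • (T x * (T x)ᴴ) + (D z * A + (D z * A)ᴴ) := by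
    simp only [hdec, smul_add, Finset.sum_add_distrib, hD, Matrix.sum_mul, conjTranspose_sum,
      Matrix.smul_mul, conjTranspose_smul, RCLike.star_def, Complex.conj_ofReal]
  have hD0 : ∑ z, D z = 0 := by
    simp only [hD]
    rw [Finset.sum_comm]
    simp_rw [← Finset.sum_smul, ← Complex.ofReal_sum, sum_centred_right]
    simp
  refine normPlus_le (ρ.isHermitian_hashed_sub_ideal f) (ρ.trace_hashed_sub_ideal f)
    fun M h0 h1 => ?_
  rw [ρ.trace_mul_hashed_sub_ideal]
  set B : Z → Matrix E E ℂ := fun z => M.submatrix (fun e => (z, e)) (fun e => (z, e)) with hB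
  have hB0 (z : Z) : 0 ≤ B z :=
    nonneg_iff_posSemidef.2 ((nonneg_iff_posSemidef.1 h0).submatrix _)
  have hB1 (z : Z) : B z ≤ 1 := by
    have := (le_iff.1 h1).submatrix (fun e : E => (z, e))
    rw [submatrix_sub, Pi.sub_apply, Pi.sub_apply,
      Matrix.submatrix_one _ (Prod.mk_right_injective z)] at this
    exact le_iff.2 this
  have hBh (z : Z) : (B z)ᴴ = B z := (nonneg_iff_posSemidef.1 (hB0 z)).isHermitian
  have hterm (z : Z) :
      (B z * ∑ x, (centred (f x) z : ℂ) • ((ρ.p x : ℂ) • ρ.st x)).trace.re =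
        ∑ x, centred (f x) z * (B z * (T x * (T x)ᴴ)).trace.re +
          2 * (A * B z * D z).trace.re := by
    have e1 : (B z * (D z * A)).trace = (A * B z * D z).trace := by
      rw [Matrix.mul_assoc, trace_mul_comm A, Matrix.mul_assoc]
    have e2 : (B z * (D z * A)ᴴ).trace.re = (B z * (D z * A)).trace.re := by
      rw [← re_trace_conjTranspose, conjTranspose_mul, conjTranspose_conjTranspose, hBh,
        trace_mul_comm]
    rw [hDA, Matrix.mul_add, Matrix.mul_add, trace_add, trace_add, Complex.add_re,
      Complex.add_re, e2, e1, Matrix.mul_sum, trace_sum, Complex.re_sum]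
    simp only [Matrix.mul_smul, trace_smul, smul_eq_mul, Complex.re_ofReal_mul]
    ring
  -- Because the D z sum to zero, each block B z may be centred at 1/2.
  have hshift : ∑ z, 2 * (A * B z * D z).trace.re =
      ∑ z, 2 * (A * (B z - (1 / 2 : ℂ) • 1) * D z).trace.re := by
    have : ∑ z, (A * D z).trace.re = 0 := by
      rw [← Complex.re_sum, ← trace_sum, ← Matrix.mul_sum, hD0]; simp
    have e (z : Z) : 2 * (A * (B z - (1 / 2 : ℂ) • 1) * D z).trace.re =
        2 * (A * B z * D z).trace.re - (A * D z).trace.re := by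
      simp only [Matrix.mul_sub, Matrix.sub_mul, Matrix.mul_smul, Matrix.smul_mul, Matrix.mul_one,
        trace_sub, trace_smul, Complex.sub_re, smul_eq_mul]
      rw [show (1 / 2 : ℂ) = ((1 / 2 : ℝ) : ℂ) by push_cast; rfl, Complex.re_ofReal_mul]
      ring
    simp_rw [e, Finset.sum_sub_distrib, this, sub_zero]
  -- The 1/|Z| part of `centred` contributes with a negative sign and is dropped; only the block z =
  -- f x remains.
  have hfirst : ∑ z, ∑ x, centred (f x) z * (B z * (T x * (T x)ᴴ)).trace.re ≤
      ∑ x, frobSq (T x) := by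
    rw [Finset.sum_comm]
    refine Finset.sum_le_sum fun x _ => ?_
    rw [sum_centred_mul]
    have h2 : 0 ≤ (Fintype.card Z : ℝ)⁻¹ * ∑ z, (B z * (T x * (T x)ᴴ)).trace.re :=
      mul_nonneg (by positivity) (Finset.sum_nonneg fun z _ =>
        re_trace_mul_self_conjTranspose_nonneg (hB0 z) _)
    linarith [re_trace_mul_self_conjTranspose_le (hB1 (f x)) (T x)]
  have hsecond : ∑ z, 2 * (A * (B z - (1 / 2 : ℂ) • 1) * D z).trace.re ≤
      t * Fintype.card Z * frobSq A / 4 + t⁻¹ * ∑ z, frobSq (D z) := by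
    have : t * Fintype.card Z * frobSq A / 4 + t⁻¹ * ∑ z, frobSq (D z) =
        ∑ z : Z, (t * (frobSq A / 4) + t⁻¹ * frobSq (D z)) := by
      rw [Finset.sum_add_distrib, Finset.mul_sum, Finset.sum_const, Finset.card_univ,
        nsmul_eq_mul]
      ring
    rw [this]
    refine Finset.sum_le_sum fun z _ => (two_re_trace_mul_le _ _ ht).trans ?_
    gcongr
    exact frobSq_mul_sub_half_le (hB0 z) (hB1 z) A
  rw [Complex.re_sum]
  refine (Finset.sum_congr rfl fun z _ => hterm z).trans_le ?_
  rw [Finset.sum_add_distrib, hshift]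
  linarith

variable (X Z) in
/-- The protocol that hashes with a uniformly random function. -/
noncomputable def Protocol.uniform [Nonempty Z] : Protocol X Z where
  prob _ := ((Fintype.card Z : ℝ) ^ Fintype.card X)⁻¹
  prob_nonneg _ := by positivity
  prob_sum := by simp

/-- The error of uniformly random hashing. -/
theorem CQState.error_uniform_le [Nonempty Z] (ρ : CQState X E)
    {R K C : X → Matrix E N ℂ} {A : Matrix E E ℂ} (hA : A.IsHermitian)
    (hR : ∀ x, R x * (R x)ᴴ = (ρ.p x : ℂ) • ρ.st x) (hK : ∀ x, K x = A * C x)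
    {t : ℝ} (ht : 0 < t) :
    (Protocol.uniform X Z).error ρ ≤ ∑ x, frobSq (R x - K x) +
      t * Fintype.card Z * frobSq A / 4 +
      t⁻¹ * ((1 - (Fintype.card Z : ℝ)⁻¹) *
        ∑ x, frobSq ((R x - (1 / 2 : ℂ) • K x) * (C x)ᴴ)) := by
  have hc : (0 : ℝ) < (Fintype.card Z : ℝ) ^ Fintype.card X := by
    have := Fintype.card_pos (α := Z)
    positivity
  rw [Protocol.error]
  change ∑ f : X → Z, ((Fintype.card Z : ℝ) ^ Fintype.card X)⁻¹ * ρ.hashError f ≤ _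
  rw [← Finset.mul_sum, inv_mul_le_iff₀ hc]
  refine (Finset.sum_le_sum fun f _ => ρ.hashError_le f hA hR hK ht).trans (le_of_eq ?_)
  rw [Finset.sum_add_distrib, ← Finset.mul_sum, sum_sum_frobSq_centred, Finset.sum_const,
    Finset.card_univ, nsmul_eq_mul, Fintype.card_fun]
  push_cast
  ring

end Hashing

/-! ### From fidelity to the error of uniform hashing -/

section Achievability

variable {X E Z : Type*} [Fintype X] [DecidableEq X] [Fintype E] [DecidableEq E] [Fintype Z]
  [DecidableEq Z]

theorem CQState.op_submatrix (ρ : CQState X E) (x : X) :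
    ρ.op.submatrix (fun e => (x, e)) (fun e => (x, e)) = (ρ.p x : ℂ) • ρ.st x := by
  ext e e'
  simp only [CQState.op, submatrix_apply, Matrix.sum_apply, Matrix.smul_apply,
    kroneckerMap_apply, Matrix.single_apply, smul_eq_mul]
  rw [Finset.sum_eq_single x]
  · simp
  · intro y _ hy; simp [hy]
  · simp

theorem single_one_nonneg (x : X) : 0 ≤ Matrix.single x x (1 : ℂ) := by
  have h : Matrix.single x x (1 : ℂ) = Matrix.single x x (1 : ℂ) * (Matrix.single x x (1 : ℂ))ᴴ := by
    simp
  rw [h]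
  exact nonneg_iff_posSemidef.2 (posSemidef_self_mul_conjTranspose _)

theorem kronecker_nonneg {k l : Type*} [Fintype k] [Fintype l] {P : Matrix k k ℂ}
    {Q : Matrix l l ℂ} (hP : 0 ≤ P) (hQ : 0 ≤ Q) : 0 ≤ P ⊗ₖ Q :=
  nonneg_iff_posSemidef.2 ((nonneg_iff_posSemidef.1 hP).kronecker (nonneg_iff_posSemidef.1 hQ))

theorem ofReal_smul_nonneg {k : Type*} [Fintype k] {P : Matrix k k ℂ} {r : ℝ} (hr : 0 ≤ r)
    (hP : 0 ≤ P) : 0 ≤ (r : ℂ) • P :=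
  nonneg_iff_posSemidef.2 ((nonneg_iff_posSemidef.1 hP).smul (Complex.zero_le_real.2 hr))

theorem CQState.op_nonneg (ρ : CQState X E) : 0 ≤ ρ.op :=
  Finset.sum_nonneg fun x _ => ofReal_smul_nonneg (ρ.p_nonneg x)
    (kronecker_nonneg (single_one_nonneg x) (ρ.st_isState x).1)

theorem CQState.trace_op (ρ : CQState X E) : ρ.op.trace = 1 := by
  simp only [CQState.op, trace_sum, trace_smul, trace_kronecker, trace_single_eq_same,
    (ρ.st_isState _).2, smul_eq_mul, mul_one]
  rw [← Complex.ofReal_sum, ρ.p_sum, Complex.ofReal_one]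

theorem frobSq_smul {k l : Type*} [Fintype k] [Fintype l] (c : ℝ) (A : Matrix k l ℂ) :
    frobSq ((c : ℂ) • A) = c ^ 2 * frobSq A := by
  simp only [frobSq, conjTranspose_smul, Matrix.smul_mul, Matrix.mul_smul, trace_smul,
    smul_eq_mul, RCLike.star_def, Complex.conj_ofReal, Complex.re_ofReal_mul]
  ring

theorem frobSq_sub_smul {k l : Type*} [Fintype k] [Fintype l] (c : ℝ) (A B : Matrix k l ℂ) :
    frobSq (A - (c : ℂ) • B) = frobSq A - 2 * c * (B * Aᴴ).trace.re + c ^ 2 * frobSq B := by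
  have h : (A * Bᴴ).trace.re = (B * Aᴴ).trace.re := by
    rw [← re_trace_conjTranspose, conjTranspose_mul, conjTranspose_conjTranspose]
  simp only [frobSq, conjTranspose_sub, conjTranspose_smul, Matrix.sub_mul, Matrix.mul_sub,
    Matrix.smul_mul, Matrix.mul_smul, trace_sub, trace_smul, Complex.sub_re, smul_eq_mul,
    RCLike.star_def, Complex.conj_ofReal, Complex.re_ofReal_mul, h]
  ring

theorem submatrix_mul_conjTranspose {k l n : Type*} [Fintype k] [Fintype l] [Fintype n]
    (A : Matrix (k × l) n ℂ) (x : k) :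
    A.submatrix (fun e => (x, e)) id * (A.submatrix (fun e => (x, e)) id)ᴴ =
      (A * Aᴴ).submatrix (fun e => (x, e)) (fun e => (x, e)) := by
  ext e e'
  simp [Matrix.mul_apply]

theorem frobSq_sqrt {n : Type*} [Fintype n] [DecidableEq n] {A : Matrix n n ℂ} (hA : 0 ≤ A) :
    frobSq (CFC.sqrt A) = A.trace.re := by
  have h : (CFC.sqrt A)ᴴ = CFC.sqrt A :=
    (nonneg_iff_posSemidef.1 (CFC.sqrt_nonneg A)).isHermitian
  rw [frobSq, h, CFC.sqrt_mul_sqrt_self A hA]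

/-- Uniformly random hashing of `ρ`, in terms of the fidelity with an operator whose diagonal
blocks are dominated by `G`. -/
theorem CQState.error_uniform_le_of_traceNorm [Nonempty Z] (ρ : CQState X E)
    {ρ' : Matrix (X × E) (X × E) ℂ} (hρ' : IsSubState ρ') {G : Matrix E E ℂ} (hG : G.PosDef)
    (hle : ∀ x, ρ'.submatrix (fun e => (x, e)) (fun e => (x, e)) ≤ G) {φ c κ B : ℝ}
    (hφ : φ ≤ traceNorm (CFC.sqrt ρ.op * CFC.sqrt ρ')) (hc : 0 ≤ c) (hB : 0 < B)
    (hκ : ((Fintype.card Z : ℝ) - 1) * G.trace.re ≤ κ)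
    (hBκ : κ * (c ^ 2 * (1 - c * φ + c ^ 2 / 4)) ≤ B ^ 2) :
    (Protocol.uniform X Z).error ρ ≤ 1 - 2 * c * φ + c ^ 2 + B := by
  have hm : (1 : ℝ) ≤ Fintype.card Z := by exact_mod_cast Fintype.card_pos (α := Z)
  have : Nonempty E := by
    by_contra hE
    rw [not_nonempty_iff] at hE
    have := ρ.trace_op
    simp [trace] at this
  have hg : 0 < G.trace.re := (Complex.lt_def.1 hG.trace_pos).1
  obtain ⟨U, hU, htr⟩ := exists_contraction_trace_eq_traceNorm (CFC.sqrt ρ.op * CFC.sqrt ρ')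
  set R := CFC.sqrt ρ.op with hR
  set L := CFC.sqrt ρ' with hL
  have hRh : Rᴴ = R := (nonneg_iff_posSemidef.1 (CFC.sqrt_nonneg _)).isHermitian
  have hLh : Lᴴ = L := (nonneg_iff_posSemidef.1 (CFC.sqrt_nonneg _)).isHermitian
  have hRR : R * R = ρ.op := CFC.sqrt_mul_sqrt_self _ ρ.op_nonneg
  have hLL : L * L = ρ' := CFC.sqrt_mul_sqrt_self _ hρ'.1
  have hLU : (L * U) * (L * U)ᴴ ≤ ρ' := by
    have := mul_mul_conjTranspose_mono hU L
    rw [Matrix.mul_one, hLh, hLL] at this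
    rwa [conjTranspose_mul, hLh, Matrix.mul_assoc, ← Matrix.mul_assoc U, ← Matrix.mul_assoc]
  have hfR : frobSq R = 1 := by
    rw [frobSq_sqrt ρ.op_nonneg, ρ.trace_op, Complex.one_re]
  have hfL : frobSq (L * U) ≤ 1 := (re_trace_mono hLU).trans (Complex.le_def.1 hρ'.2).1
  have hcross : φ ≤ (L * U * Rᴴ).trace.re := by
    rw [hRh, trace_mul_comm, ← Matrix.mul_assoc, htr]
    exact hφ
  have hT : frobSq (R - (c : ℂ) • (L * U)) ≤ 1 - 2 * c * φ + c ^ 2 := by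
    rw [frobSq_sub_smul, hfR]
    nlinarith [mul_le_mul_of_nonneg_left hcross hc, mul_le_mul_of_nonneg_left hfL (sq_nonneg c)]
  have hS : frobSq (R - (1 / 2 : ℂ) • (c : ℂ) • (L * U)) ≤ 1 - c * φ + c ^ 2 / 4 := by
    rw [smul_smul, show (1 / 2 : ℂ) * c = ((c / 2 : ℝ) : ℂ) by push_cast; ring, frobSq_sub_smul,
      hfR]
    nlinarith [mul_le_mul_of_nonneg_left hcross hc, mul_le_mul_of_nonneg_left hfL (sq_nonneg c)]
  set A := CFC.sqrt G with hA
  have hG0 : 0 ≤ G := nonneg_iff_posSemidef.2 hG.posSemidef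
  have hAA : A * A = G := CFC.sqrt_mul_sqrt_self _ hG0
  have hAh : Aᴴ = A := (nonneg_iff_posSemidef.1 (CFC.sqrt_nonneg _)).isHermitian
  have hAdet : IsUnit A.det := by
    have : IsUnit (A * A).det := (isUnit_iff_isUnit_det _).1 (hAA ▸ hG.isUnit)
    rw [det_mul] at this
    exact isUnit_of_mul_isUnit_left this
  have hAih : (A⁻¹)ᴴ = A⁻¹ := by rw [conjTranspose_nonsing_inv, hAh]
  set row : Matrix (X × E) (X × E) ℂ → X → Matrix E (X × E) ℂ :=
    fun W x => W.submatrix (fun e => (x, e)) id with hrow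
  -- Conjugating the block bound by G^{-1/2} gives CC† ≤ 1; the order is then swapped because S C†
  -- is estimated through C†C.
  have hC1 (x : X) : (A⁻¹ * row (L * U) x)ᴴ * (A⁻¹ * row (L * U) x) ≤ 1 := by
    refine conjTranspose_mul_self_le_one ?_
    have h1 : row (L * U) x * (row (L * U) x)ᴴ ≤ G := by
      rw [hrow, submatrix_mul_conjTranspose]
      refine le_trans (le_iff.2 ?_) (hle x)
      exact (le_iff.1 hLU).submatrix (fun e : E => (x, e))
    have h2 := mul_mul_conjTranspose_mono h1 A⁻¹
    have h3 : A⁻¹ * G * (A⁻¹)ᴴ = 1 := by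
      rw [hAih, ← hAA, ← Matrix.mul_assoc, nonsing_inv_mul _ hAdet, Matrix.one_mul,
        mul_nonsing_inv _ hAdet]
    rw [h3] at h2
    simpa only [conjTranspose_mul, Matrix.mul_assoc] using h2
  have hRrow (x : X) : row R x * (row R x)ᴴ = (ρ.p x : ℂ) • ρ.st x := by
    rw [hrow, submatrix_mul_conjTranspose, hRh, hRR, ρ.op_submatrix]
  have hKrow (x : X) : row ((c : ℂ) • (L * U)) x =
      A * ((c : ℂ) • (A⁻¹ * row (L * U) x)) := by
    rw [Matrix.mul_smul, ← Matrix.mul_assoc, mul_nonsing_inv _ hAdet, Matrix.one_mul]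
    rfl
  set m : ℝ := (Fintype.card Z : ℝ) with hmdef
  -- This Young parameter makes the term in Tr G exactly B/2; the second-moment term is then at most
  -- B/2 by `hBκ`.
  have ht : 0 < 2 * B / (m * G.trace.re) := by positivity
  have key := ρ.error_uniform_le (Z := Z) (R := row R) (K := row ((c : ℂ) • (L * U)))
    (C := fun x => (c : ℂ) • (A⁻¹ * row (L * U) x)) (A := A) hAh hRrow hKrow ht
  have hTrow : ∑ x, frobSq (row R x - row ((c : ℂ) • (L * U)) x) =
      frobSq (R - (c : ℂ) • (L * U)) :=
    sum_frobSq_rows (R - (c : ℂ) • (L * U))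
  have hSrow : ∑ x, frobSq ((row R x - (1 / 2 : ℂ) • row ((c : ℂ) • (L * U)) x) *
      ((c : ℂ) • (A⁻¹ * row (L * U) x))ᴴ) ≤ c ^ 2 * (1 - c * φ + c ^ 2 / 4) := by
    have e : ∑ x, frobSq (row R x - (1 / 2 : ℂ) • row ((c : ℂ) • (L * U)) x) =
        frobSq (R - (1 / 2 : ℂ) • (c : ℂ) • (L * U)) :=
      sum_frobSq_rows (R - (1 / 2 : ℂ) • (c : ℂ) • (L * U))
    refine le_trans ?_ (mul_le_mul_of_nonneg_left hS (sq_nonneg c))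
    rw [← e, Finset.mul_sum]
    refine Finset.sum_le_sum fun x _ => ?_
    rw [conjTranspose_smul, Matrix.mul_smul, RCLike.star_def, Complex.conj_ofReal, frobSq_smul]
    exact mul_le_mul_of_nonneg_left (frobSq_mul_conjTranspose_le (hC1 x) _) (sq_nonneg c)
  rw [hTrow, frobSq_sqrt hG0] at key
  have h4 : 2 * B / (m * G.trace.re) * m * G.trace.re / 4 = B / 2 := by field_simp; ring
  rw [h4] at key
  have h5 : (2 * B / (m * G.trace.re))⁻¹ * ((1 - m⁻¹) *
      ∑ x, frobSq ((row R x - (1 / 2 : ℂ) • row ((c : ℂ) • (L * U)) x) *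
      ((c : ℂ) • (A⁻¹ * row (L * U) x))ᴴ)) ≤ B / 2 := by
    set Q := ∑ x, frobSq ((row R x - (1 / 2 : ℂ) • row ((c : ℂ) • (L * U)) x) *
      ((c : ℂ) • (A⁻¹ * row (L * U) x))ᴴ) with hQ
    have hQ0 : 0 ≤ Q := Finset.sum_nonneg fun x _ => frobSq_nonneg _
    have e : (2 * B / (m * G.trace.re))⁻¹ * ((1 - m⁻¹) * Q) =
        ((m - 1) * G.trace.re * Q) / (2 * B) := by
      field_simp
    rw [e, div_le_iff₀ (by positivity)]
    have h0 : 0 ≤ (m - 1) * G.trace.re := mul_nonneg (by linarith) hg.le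
    calc (m - 1) * G.trace.re * Q
        ≤ κ * (c ^ 2 * (1 - c * φ + c ^ 2 / 4)) :=
          mul_le_mul hκ hSrow hQ0 (h0.trans hκ)
      _ ≤ B ^ 2 := hBκ
      _ = B / 2 * (2 * B) := by ring
  linarith

/-- Uniformly random hashing succeeds when the output is short compared to the min-entropy of a
nearby sub-normalised state. -/
theorem CQState.error_uniform_le_of_purifiedDist [Nonempty Z] (ρ : CQState X E)
    {ρ' : Matrix (X × E) (X × E) ℂ} (hρ' : IsSubState ρ') {G : Matrix E E ℂ} (hG : G.PosDef)
    (hle : ∀ x, ρ'.submatrix (fun e => (x, e)) (fun e => (x, e)) ≤ G) {ε μ : ℝ} (hε : ε < 1)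
    (h0μ : 0 < μ) (hμε : μ < ε) (hP : purifiedDist ρ.op ρ' ≤ Real.sqrt (ε - μ))
    (hκ : ((Fintype.card Z : ℝ) - 1) * G.trace.re ≤ 4 * μ ^ 3) :
    (Protocol.uniform X Z).error ρ ≤ ε := by
  set φ := Real.sqrt (1 - ε + μ) with hφ
  have hφ2 : φ ^ 2 = 1 - ε + μ := Real.sq_sqrt (by linarith)
  have hφF : φ ≤ traceNorm (CFC.sqrt ρ.op * CFC.sqrt ρ') := by
    rw [purifiedDist, Real.sqrt_le_sqrt_iff (by linarith), fidelity] at hP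
    exact Real.sqrt_le_iff.2 ⟨traceNorm_nonneg _, by linarith⟩
  have hφ0 : 0 ≤ φ := Real.sqrt_nonneg _
  have hφμ : μ ≤ φ ^ 2 := by rw [hφ2]; linarith
  have hφ1 : φ ^ 2 ≤ 1 := by rw [hφ2]; linarith
  rcases le_total μ (3 / 4) with h | h
  -- Here c = φ and B = μ, so the total is 1 - φ² + μ = ε. The factor φ²(1 - 3φ²/4) peaks at 1/3 for
  -- φ² = 2/3, so 4μ/3 ≤ 1 is needed.
  · refine (ρ.error_uniform_le_of_traceNorm hρ' hG hle hφF hφ0 h0μ hκ ?_).trans ?_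
    · have h1 : φ ^ 2 * (1 - φ * φ + φ ^ 2 / 4) ≤ 1 / 3 := by
        nlinarith [sq_nonneg (φ ^ 2 - 2 / 3)]
      have h2 : 0 ≤ 4 * μ ^ 3 := by positivity
      calc 4 * μ ^ 3 * (φ ^ 2 * (1 - φ * φ + φ ^ 2 / 4)) ≤ 4 * μ ^ 3 * (1 / 3) :=
            mul_le_mul_of_nonneg_left h1 h2
        _ = μ ^ 2 * (4 / 3 * μ) := by ring
        _ ≤ μ ^ 2 * 1 := mul_le_mul_of_nonneg_left (by linarith) (sq_nonneg μ)
        _ = μ ^ 2 := mul_one _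
    · nlinarith
  -- For large μ take c = φ/2, where B = μ - φ²/4 again gives total ε. The worst case is φ² = 1,
  -- leaving 9μ³/16 ≤ (μ - 1/4)², whose difference is (1-μ)(9μ² - 7μ + 1)/16.
  · have hB : 0 < μ - φ ^ 2 / 4 := by linarith
    refine (ρ.error_uniform_le_of_traceNorm hρ' hG hle hφF (c := φ / 2) (by positivity) hB hκ
      ?_).trans ?_
    · have h1 : (φ / 2) ^ 2 * (1 - φ / 2 * φ + (φ / 2) ^ 2 / 4) ≤ 9 / 64 := by
        nlinarith
      have h2 : (μ - 1 / 4) ^ 2 ≤ (μ - φ ^ 2 / 4) ^ 2 := by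
        apply pow_le_pow_left₀ <;> linarith
      have h3 : 4 * μ ^ 3 * (9 / 64) ≤ (μ - 1 / 4) ^ 2 := by
        have : 0 ≤ (1 - μ) * (9 * μ ^ 2 - 7 * μ + 1) :=
          mul_nonneg (by linarith) (by nlinarith)
        nlinarith
      have h4 := mul_le_mul_of_nonneg_left h1 (by positivity : 0 ≤ 4 * μ ^ 3)
      linarith
    · nlinarith

end Achievability

/-! ### Existence of the maximum and the one-more-symbol step -/

section Extractable

variable {X E Z : Type*} [Fintype X] [DecidableEq X] [Fintype E] [DecidableEq E] [Fintype Z]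
  [DecidableEq Z]

theorem CQState.error_nonpos_of_subsingleton [Nonempty Z] [Subsingleton Z] (F : Protocol X Z)
    (ρ : CQState X E) : F.error ρ ≤ 0 := by
  refine Finset.sum_nonpos fun f _ => mul_nonpos_of_nonneg_of_nonpos (F.prob_nonneg f) ?_
  have hc : Fintype.card Z = 1 :=
    le_antisymm (Fintype.card_le_one_iff_subsingleton.2 ‹_›) Fintype.card_pos
  have h0 (y z : Z) : centred y z = 0 := by simp [centred, hc, Subsingleton.elim y z]
  refine normPlus_le (ρ.isHermitian_hashed_sub_ideal f) (ρ.trace_hashed_sub_ideal f)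
    fun M _ _ => ?_
  rw [ρ.trace_mul_hashed_sub_ideal]
  simp [h0]

/-- Testing for the range of the hash function bounds the error from below. -/
theorem CQState.one_sub_card_div_le_hashError [Nonempty Z] (ρ : CQState X E) (f : X → Z) :
    1 - (Fintype.card X : ℝ) / Fintype.card Z ≤ ρ.hashError f := by
  -- The test is the projector onto the image of f, tensored with 1: the hashed state passes surely,
  -- the ideal one with probability at most |X|/|Z|.
  set d : Z × E → ℂ := fun i => if i.1 ∈ Finset.univ.image f then 1 else 0 with hd
  have h0 : 0 ≤ diagonal d := by
    refine nonneg_iff_posSemidef.2 (posSemidef_diagonal_iff.2 fun i => ?_)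
    simp only [hd]; split_ifs <;> simp
  have h1 : diagonal d ≤ 1 := by
    rw [← diagonal_one, le_iff, diagonal_sub]
    refine posSemidef_diagonal_iff.2 fun i => ?_
    simp only [hd]; split_ifs <;> simp
  have h := re_trace_mul_le_normPlus (ρ.isHermitian_hashed_sub_ideal f)
    (ρ.trace_hashed_sub_ideal f) h0 h1
  refine le_trans ?_ h
  rw [ρ.trace_mul_hashed_sub_ideal]
  have hsub (z : Z) : (diagonal d).submatrix (fun e : E => (z, e)) (fun e => (z, e)) =
      (if z ∈ Finset.univ.image f then 1 else 0 : ℂ) • 1 := by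
    rw [submatrix_diagonal _ _ (Prod.mk_right_injective z), smul_one_eq_diagonal]
    rfl
  have hterm (z : Z) : ((diagonal d).submatrix (fun e : E => (z, e)) (fun e => (z, e)) *
      ∑ x, (centred (f x) z : ℂ) • ((ρ.p x : ℂ) • ρ.st x)).trace.re =
      ∑ x, centred (f x) z * (if z ∈ Finset.univ.image f then 1 else 0) * ρ.p x := by
    rw [hsub, Matrix.smul_mul, Matrix.one_mul, trace_smul, trace_sum]
    simp only [trace_smul, (ρ.st_isState _).2, smul_eq_mul, mul_one]
    split_ifs <;> simp
  rw [Complex.re_sum]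
  simp_rw [hterm]
  rw [Finset.sum_comm]
  simp_rw [← Finset.sum_mul, sum_centred_mul]
  have hcard : ((Finset.univ.image f).card : ℝ) ≤ Fintype.card X := by
    exact_mod_cast Finset.card_image_le
  simp only [Finset.mem_image_of_mem f (Finset.mem_univ _), if_true, Finset.sum_boole,
    Finset.filter_mem_eq_inter, Finset.univ_inter]
  rw [← Finset.mul_sum, ρ.p_sum, mul_one, div_eq_inv_mul]
  gcongr

theorem CQState.card_mul_one_sub_le [Nonempty Z] (F : Protocol X Z) (ρ : CQState X E) :
    (Fintype.card Z : ℝ) * (1 - F.error ρ) ≤ Fintype.card X := by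
  have h : 1 - (Fintype.card X : ℝ) / Fintype.card Z ≤ F.error ρ := by
    calc 1 - (Fintype.card X : ℝ) / Fintype.card Z
        = ∑ f, F.prob f * (1 - (Fintype.card X : ℝ) / Fintype.card Z) := by
          rw [← Finset.sum_mul, F.prob_sum, one_mul]
      _ ≤ F.error ρ := Finset.sum_le_sum fun f _ =>
          mul_le_mul_of_nonneg_left (ρ.one_sub_card_div_le_hashError f) (F.prob_nonneg f)
  have hZ : (0 : ℝ) < Fintype.card Z := by exact_mod_cast Fintype.card_pos
  have := mul_le_mul_of_nonneg_left h hZ.le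
  rw [mul_sub, mul_div_cancel₀ _ hZ.ne'] at this
  linarith

theorem achievableLengths_finite (b : ℝ) {ε : ℝ} (hε : ε < 1) (ρ : CQState X E) :
    (achievableLengths b ε ρ).Finite := by
  refine ((Finset.range (⌊(Fintype.card X : ℝ) / (1 - ε)⌋₊ + 1)).finite_toSet.image
    fun m : ℕ => Real.logb b m).subset ?_
  rintro r ⟨m, hm, F, hF, rfl⟩
  refine ⟨m, ?_, rfl⟩
  have : Nonempty (Fin m) := ⟨⟨0, hm⟩⟩
  have h := ρ.card_mul_one_sub_le F
  rw [Fintype.card_fin] at h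
  rw [Finset.mem_coe, Finset.mem_range, Nat.lt_succ_iff]
  refine Nat.le_floor ?_
  rw [le_div_iff₀ (by linarith)]
  exact (mul_le_mul_of_nonneg_left (by linarith) (Nat.cast_nonneg m)).trans h

theorem achievableLengths_nonempty (b : ℝ) {ε : ℝ} (hε : 0 ≤ ε) (ρ : CQState X E) :
    (achievableLengths b ε ρ).Nonempty :=
  ⟨_, 1, le_rfl, Protocol.uniform X (Fin 1),
    (ρ.error_nonpos_of_subsingleton _).trans hε, rfl⟩

theorem isGreatest_extractable (b : ℝ) {ε : ℝ} (h0 : 0 ≤ ε) (h1 : ε < 1) (ρ : CQState X E) :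
    IsGreatest (achievableLengths b ε ρ) (extractable b ε ρ) :=
  ⟨(achievableLengths_nonempty b h0 ρ).csSup_mem (achievableLengths_finite b h1 ρ),
    fun _ hr => le_csSup (achievableLengths_finite b h1 ρ).bddAbove hr⟩

/-- If `m` is too short for the min-entropy of a nearby sub-normalised state, then one more
output symbol is achievable. -/
theorem CQState.error_uniform_succ_le (ρ : CQState X E) {ρ' : Matrix (X × E) (X × E) ℂ}
    (hρ' : IsSubState ρ') {σ : Matrix E E ℂ} (hσ : IsState σ) {t : ℝ} (ht : 0 ≤ t)
    (hle : ρ' ≤ (t : ℂ) • ((1 : Matrix X X ℂ) ⊗ₖ σ)) {ε μ : ℝ} (hε : ε < 1) (h0μ : 0 < μ)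
    (hμε : μ < ε) (hP : purifiedDist ρ.op ρ' ≤ Real.sqrt (ε - μ)) {m : ℕ} (hm : 1 ≤ m)
    (hlt : m * t < 4 * μ ^ 3) :
    (Protocol.uniform X (Fin (m + 1))).error ρ ≤ ε := by
  have hm0 : (0 : ℝ) < m := by exact_mod_cast hm
  -- G must be invertible, but σ need not be. Adding η1 costs mη|E| in m Tr G, and the |E|+1 in the
  -- denominator keeps this below the slack 4μ³ - mt.
  set η : ℝ := (4 * μ ^ 3 - m * t) / (m * (Fintype.card E + 1)) with hη
  have hη0 : 0 < η := div_pos (by linarith) (by positivity)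
  set G : Matrix E E ℂ := (t : ℂ) • σ + (η : ℂ) • 1 with hG
  have htσ : 0 ≤ (t : ℂ) • σ := ofReal_smul_nonneg ht hσ.1
  have hη1 : ((η : ℂ) • (1 : Matrix E E ℂ)).PosDef :=
    PosDef.one.smul (Complex.zero_lt_real.2 hη0)
  refine ρ.error_uniform_le_of_purifiedDist hρ' (G := G)
    (hη1.posSemidef_add (nonneg_iff_posSemidef.1 htσ)) (fun x => ?_) hε h0μ hμε hP ?_
  · have h1 := (le_iff.1 hle).submatrix (fun e : E => (x, e))
    have h2 : (t • ((1 : Matrix X X ℂ) ⊗ₖ σ) : Matrix (X × E) (X × E) ℂ).submatrix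
        (fun e : E => (x, e)) (fun e => (x, e)) = (t : ℂ) • σ := by
      ext e e'; simp
    have h3 : ρ'.submatrix (fun e : E => (x, e)) (fun e => (x, e)) ≤ (t : ℂ) • σ := by
      rw [← h2]; exact le_iff.2 h1
    exact h3.trans (le_add_of_nonneg_right (nonneg_iff_posSemidef.2 hη1.posSemidef))
  · have htr : G.trace.re = t + η * Fintype.card E := by
      rw [hG, trace_add, trace_smul, trace_smul, hσ.2, trace_one, smul_eq_mul, smul_eq_mul,
        Complex.add_re, Complex.re_ofReal_mul, Complex.re_ofReal_mul, Complex.one_re,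
        Complex.natCast_re, mul_one]
    have h1 : m * (η * (Fintype.card E + 1)) = 4 * μ ^ 3 - m * t := by
      rw [hη]; field_simp
    rw [htr, Fintype.card_fin]
    push_cast
    nlinarith [mul_pos hm0 hη0]

theorem elogb_mono {b : ℝ} (hb : 1 < b) {x y : ℝ≥0∞} (h : x ≤ y) : elogb b x ≤ elogb b y :=
  EReal.div_le_div_right_of_nonneg (EReal.coe_nonneg.2 (Real.log_pos hb).le)
    (ENNReal.log_monotone h)

theorem elogb_ofReal (b : ℝ) {x : ℝ} (hx : 0 < x) :
    elogb b (ENNReal.ofReal x) = ((Real.logb b x : ℝ) : EReal) := by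
  rw [elogb, ENNReal.log_ofReal, if_neg hx.not_ge, Real.logb, EReal.coe_div]

/-- The smooth min-entropy is bounded if all feasible values of `λ` are bounded below. -/
theorem HminP_le {b : ℝ} (hb : 1 < b) {δ r : ℝ} (hr : 0 < r) {ρ : Matrix (X × E) (X × E) ℂ}
    (h : ∀ (σ : Matrix E E ℂ) (ρ' : Matrix (X × E) (X × E) ℂ) (t : ℝ), IsState σ →
      IsSubState ρ' → purifiedDist ρ ρ' ≤ δ → 0 ≤ t →
      ρ' ≤ (t : ℂ) • ((1 : Matrix X X ℂ) ⊗ₖ σ) → r ≤ t) :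
    HminP b δ ρ ≤ ((-Real.logb b r : ℝ) : EReal) := by
  rw [HminP, EReal.coe_neg, EReal.neg_le_neg_iff, ← elogb_ofReal b hr]
  refine le_iInf₂ fun σ hσ => le_iInf₂ fun ρ' hρ' => elogb_mono hb (le_iInf₂ fun t ht => ?_)
  exact ENNReal.ofReal_le_of_le_toReal (by simpa using h σ ρ' t hσ hρ'.1 hρ'.2 t.2 ht)

end Extractable

end PrivacyAmp

/-! ### The main theorem -/

theorem mainTheorem8 {X E : Type*} [Fintype X] [DecidableEq X] [Fintype E] [DecidableEq E]
    (b : ℝ) (hb : 1 < b) (ρ : PrivacyAmp.CQState X E)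
    (ε μ : ℝ) (hε : ε ∈ Set.Ioo (0 : ℝ) 1) (hμ : μ ∈ Set.Ioo (0 : ℝ) ε) :
    IsGreatest (PrivacyAmp.achievableLengths b ε ρ) (PrivacyAmp.extractable b ε ρ) ∧
    (∃ m : ℕ, 1 ≤ m ∧ ∃ F : PrivacyAmp.Protocol X (Fin m), F.error ρ ≤ ε ∧
      PrivacyAmp.HminP b (Real.sqrt (ε - μ)) ρ.op
          - ((Real.logb b (1 / (4 * μ ^ 3)) : ℝ) : EReal)
        ≤ ((Real.logb b m : ℝ) : EReal)) ∧
    PrivacyAmp.HminP b (Real.sqrt (ε - μ)) ρ.op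
        - ((Real.logb b (1 / (4 * μ ^ 3)) : ℝ) : EReal)
      ≤ ((PrivacyAmp.extractable b ε ρ : ℝ) : EReal) := by
  have hgr := PrivacyAmp.isGreatest_extractable b hε.1.le hε.2 ρ
  obtain ⟨m, hm, F, hF, hmax⟩ := hgr.1
  have hm0 : (0 : ℝ) < m := by exact_mod_cast hm
  have hμ3 : 0 < 4 * μ ^ 3 := by have := hμ.1; positivity
  have hbound : PrivacyAmp.HminP b (Real.sqrt (ε - μ)) ρ.op
      - ((Real.logb b (1 / (4 * μ ^ 3)) : ℝ) : EReal) ≤ ((Real.logb b m : ℝ) : EReal) := by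
    have h := PrivacyAmp.HminP_le (r := 4 * μ ^ 3 / m) hb (div_pos hμ3 hm0)
      (δ := Real.sqrt (ε - μ)) (ρ := ρ.op) fun σ ρ' t hσ hρ' hP ht hle => by
        rw [div_le_iff₀' hm0]
        -- Otherwise m + 1 symbols would be achievable, contradicting the maximality of m.
        by_contra! hlt
        have hach := hgr.2 ⟨m + 1, by omega, _,
          ρ.error_uniform_succ_le hρ' hσ ht hle hε.2 hμ.1 hμ.2 hP hm hlt, rfl⟩
        rw [hmax, Real.logb_le_logb hb (by positivity) hm0] at hach
        push_cast at hach
        linarith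
    refine (EReal.sub_le_sub h le_rfl).trans (le_of_eq ?_)
    rw [← EReal.coe_sub, Real.logb_div hμ3.ne' hm0.ne', Real.logb_div one_ne_zero hμ3.ne',
      Real.logb_one]
    congr 1
    ring
  exact ⟨hgr, ⟨m, hm, F, hF, hbound⟩, hmax ▸ hbound⟩
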